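/- Let $X$ be a compact, locally path connected metric space and let $\Phi: X\times\mathbf R\to X$, $(x,t)\mapsto x\cdot t$, be a continuous flow. Let $R=R(\Phi)$ be the chain recurrent set of $\Phi$: the set of all $x\in X$ such that for every $\delta>0$ and $T\ge 1$ there are $N\ge 1$, points $x=x_0,x_1,\dots,x_N=x$ of $X$ and numbers $t_1,\dots,t_N\ge T$ with $d(x_{i-1}\cdot t_i,x_i)<\delta$ for $1\le i\le N$. A continuous closed one-form $\omega$ on a topological space is an equivalence class of families $\{\varphi_U\}_{U\in\mathcal U}$ of continuous functions $\varphi_U:U\to\mathbf R$ on the members of an open cover $\mathcal U$ such that all differences $\varphi_U-\varphi_V$ are locally constant on $U\cap V$; two families are equivalent if their union has the same property. The differences $\varphi_V-\varphi_U$ form a Čech cocycle with values in locally constant functions, whose class is denoted $[\omega]\in\check H^1(X;\mathbf R)$. A continuous function $f$ on the whole space defines the one-form $df$, and $\omega|_A$ denotes the restriction of $\omega$ to a subspace $A$. For a path $\gamma:[0,1]\to X$, put $\int_\gamma\omega=\sum_{i}\big(\varphi_{U_i}(\gamma(t_{i}))-\varphi_{U_i}(\gamma(t_{i-1}))\big)$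 for any subdivision $0=t_0\le\dots\le t_N=1$ and any $U_i\in\mathcal U$ with $\gamma([t_{i-1},t_i])\subset U_i$. For a closed $\Phi$-invariant subset $Y\subset X$, a continuous closed one-form $\omega$ on $X$ is called a Lyapunov one-form for $(\Phi,Y)$ if 1. $\int_x^{x\cdot t}\omega<0$ for all $x\in X\setminus Y$ and $t>0$, the integral being taken along the trajectory of $\Phi$; and 2. there are an open neighborhood $U$ of $Y$ and a continuous function $f:U\to\mathbf R$ such that $\omega|_U=df$ and $f$ is constant on every connected component of $Y$. Then for every Čech cohomology class $\xi\in\check H^1(X;\mathbf R)$ with $\xi|_R=0$ in $\check H^1(R;\mathbf R)$ there exists a Lyapunov one-form $\omega$ for $(\Phi,R)$ with $[\omega]=\xi$. -/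

import Mathlib

open Set Filter Topology TopologicalSpace

noncomputable section

/-! ### First Čech cohomology with real coefficients

Čech cohomology `Ȟ¹(X; ℝ)` of the sheaf of locally constant real functions, as the direct limit of
the cohomology of the Čech complexes of the open covers of `X`. As usual the direct limit is taken
over covers indexed by the points of the space, which are cofinal among all open covers and make
the refinement maps canonical. -/

/-- An open cover of `X` indexed by the points of `X`: a choice of an open neighbourhood `U x` of
every point `x`. -/
structure PointedCover (X : Type*) [TopologicalSpace X] where
  /-- the chosen neighbourhood of a point -/
  nhd : X → Opens X
  mem_nhd : ∀ x, x ∈ nhd x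

namespace PointedCover

variable {X Y : Type*} [TopologicalSpace X] [TopologicalSpace Y]

/-- `U ≤ V` means that `V` is finer than `U`. -/
instance : Preorder (PointedCover X) where
  le U V := ∀ x, V.nhd x ≤ U.nhd x
  le_refl _ _ := le_rfl
  le_trans _ _ _ h₁ h₂ x := (h₂ x).trans (h₁ x)

/-- The preimage of a cover under a continuous map. -/
def pullback (f : C(Y, X)) (U : PointedCover X) : PointedCover Y where
  nhd y := (U.nhd (f y)).comap f
  mem_nhd y := U.mem_nhd (f y)

/-- Čech `0`-cochains: a locally constant function on every member of the cover. -/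
abbrev C0 (U : PointedCover X) : Type _ := ∀ x, LocallyConstant (U.nhd x) ℝ

/-- Čech `1`-cochains. -/
abbrev C1 (U : PointedCover X) : Type _ :=
  ∀ x y, LocallyConstant (U.nhd x ⊓ U.nhd y : Opens X) ℝ

/-- Čech `2`-cochains. -/
abbrev C2 (U : PointedCover X) : Type _ :=
  ∀ x y z, LocallyConstant (U.nhd x ⊓ U.nhd y ⊓ U.nhd z : Opens X) ℝ

/-- Restriction of locally constant functions to a smaller open set. -/
def resₗ {V U : Opens X} (h : V ≤ U) : LocallyConstant U ℝ →ₗ[ℝ] LocallyConstant V ℝ :=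
  LocallyConstant.comapₗ ℝ ⟨fun p => ⟨p.1, h p.2⟩, by fun_prop⟩

@[simp] theorem resₗ_apply {V U : Opens X} (h : V ≤ U) (c : LocallyConstant U ℝ) (p : V) :
    resₗ h c p = c ⟨p.1, h p.2⟩ := rfl

/-- Pull-back of locally constant functions on an open set `U` to an open set `V` that `f` maps
into `U`. -/
def pullₗ (f : C(Y, X)) {V : Opens Y} {U : Opens X} (h : ∀ p ∈ V, f p ∈ U) :
    LocallyConstant U ℝ →ₗ[ℝ] LocallyConstant V ℝ :=
  LocallyConstant.comapₗ ℝ ⟨fun p => ⟨f p.1, h p.1 p.2⟩, by fun_prop⟩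

@[simp] theorem pullₗ_apply (f : C(Y, X)) {V : Opens Y} {U : Opens X} (h : ∀ p ∈ V, f p ∈ U)
    (c : LocallyConstant U ℝ) (p : V) : pullₗ f h c p = c ⟨f p.1, h p.1 p.2⟩ := rfl

/-- The Čech differential `(d s)_{xy} = s_y - s_x`. -/
def d0 (U : PointedCover X) : U.C0 →ₗ[ℝ] U.C1 where
  toFun s x y := resₗ inf_le_right (s y) - resₗ inf_le_left (s x)
  map_add' s t := by funext x y; ext p; simp [LocallyConstant.sub_apply]; ring
  map_smul' r s := by funext x y; ext p; simp [LocallyConstant.sub_apply]; ring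

/-- The Čech differential `(d c)_{xyz} = c_{yz} - c_{xz} + c_{xy}`. -/
def d1 (U : PointedCover X) : U.C1 →ₗ[ℝ] U.C2 where
  toFun c x y z :=
    resₗ (inf_le_inf_right _ inf_le_right) (c y z) - resₗ (inf_le_inf_right _ inf_le_left) (c x z)
      + resₗ inf_le_left (c x y)
  map_add' s t := by funext x y z; ext p; simp [LocallyConstant.sub_apply]; ring
  map_smul' r s := by funext x y z; ext p; simp [LocallyConstant.sub_apply]; ring

/-- Čech `1`-cocycles of a cover. -/
abbrev Z1 (U : PointedCover X) : Submodule ℝ U.C1 := LinearMap.ker U.d1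

/-- Čech `1`-coboundaries of a cover, as a subspace of the space of cocycles. -/
abbrev B1 (U : PointedCover X) : Submodule ℝ U.Z1 := (LinearMap.range U.d0).submoduleOf U.Z1

/-- First Čech cohomology of a cover. -/
abbrev H1 (U : PointedCover X) : Type _ := U.Z1 ⧸ U.B1

/-- `V` refines the preimage of `U` under `f`, with `y ↦ f y` as the refinement function. -/
def Over (f : C(Y, X)) (U : PointedCover X) (V : PointedCover Y) : Prop :=
  ∀ y, ∀ p ∈ V.nhd y, f p ∈ U.nhd (f y)

theorem over_id {U V : PointedCover X} (h : U ≤ V) : Over (.id X) U V := fun x _ hp => h x hp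

theorem over_pullback (f : C(Y, X)) (U : PointedCover X) : Over f U (U.pullback f) :=
  fun _ _ hp => hp

/-- Pull-back of `1`-cochains: `(f^* c)_{y y'} = c_{f y, f y'} ∘ f`. -/
def cochainMap (f : C(Y, X)) {U : PointedCover X} {V : PointedCover Y} (h : Over f U V) :
    U.C1 →ₗ[ℝ] V.C1 where
  toFun c y y' := pullₗ f (fun p hp => by exact ⟨h y p hp.1, h y' p hp.2⟩) (c (f y) (f y'))
  map_add' c c' := by funext x y; simp
  map_smul' r c := by funext x y; simp

theorem cochainMap_mem_Z1 (f : C(Y, X)) {U : PointedCover X} {V : PointedCover Y}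
    (h : Over f U V) (c : U.C1) (hc : c ∈ U.Z1) : cochainMap f h c ∈ V.Z1 := by
  rw [LinearMap.mem_ker] at hc ⊢
  funext x y z
  ext p
  have := congrArg (fun k : U.C2 => k (f x) (f y) (f z)
    ⟨f p.1, ⟨h x _ p.2.1.1, h y _ p.2.1.2⟩, h z _ p.2.2⟩) hc
  exact this

/-- Pull-back of `1`-cocycles. -/
def cocycleMap (f : C(Y, X)) {U : PointedCover X} {V : PointedCover Y} (h : Over f U V) :
    U.Z1 →ₗ[ℝ] V.Z1 :=
  (cochainMap f h).restrict (cochainMap_mem_Z1 f h)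

theorem B1_le_comap (f : C(Y, X)) {U : PointedCover X} {V : PointedCover Y} (h : Over f U V) :
    U.B1 ≤ V.B1.comap (cocycleMap f h) := by
  rintro ⟨c, hc⟩ ⟨s, hs⟩
  refine ⟨fun y => pullₗ f (h y) (s (f y)), ?_⟩
  replace hs : U.d0 s = c := hs
  subst hs
  rfl

/-- The map induced on the first cohomology of covers by a continuous map. -/
def h1Map (f : C(Y, X)) {U : PointedCover X} {V : PointedCover Y} (h : Over f U V) :
    U.H1 →ₗ[ℝ] V.H1 :=
  Submodule.mapQ _ _ (cocycleMap f h) (B1_le_comap f h)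

/-- The refinement map of cohomology, for a cover `V` finer than `U`. -/
def refine (U V : PointedCover X) (h : U ≤ V) : U.H1 →ₗ[ℝ] V.H1 :=
  h1Map (.id X) (over_id h)

end PointedCover

open Classical in
/-- The first Čech cohomology `Ȟ¹(X; ℝ)`. -/
abbrev CechH1 (X : Type*) [TopologicalSpace X] : Type _ :=
  Module.DirectLimit (R := ℝ) (ι := PointedCover X) (fun U => U.H1) PointedCover.refine

namespace CechH1

variable {X Y : Type*} [TopologicalSpace X] [TopologicalSpace Y]

open Classical in
/-- The class in `Ȟ¹(X; ℝ)` of a class of a cover. -/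
def of (U : PointedCover X) : U.H1 →ₗ[ℝ] CechH1 X :=
  Module.DirectLimit.of ℝ (PointedCover X) (fun U => U.H1) PointedCover.refine U

/-- The class in `Ȟ¹(X; ℝ)` of a Čech cocycle of a cover. -/
def mk (U : PointedCover X) (c : U.Z1) : CechH1 X := of U (Submodule.Quotient.mk c)

open Classical in
theorem of_refine {U V : PointedCover X} (h : U ≤ V) (a : U.H1) :
    of V (PointedCover.refine U V h a) = of U a :=
  Module.DirectLimit.of_f

theorem mk_eq_mk {U V W : PointedCover X} (hU : U ≤ W) (hV : V ≤ W) (c : U.Z1) (c' : V.Z1)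
    (s : W.C0) (hs : W.d0 s = PointedCover.cochainMap (.id X) (PointedCover.over_id hU) c.1 -
      PointedCover.cochainMap (.id X) (PointedCover.over_id hV) c'.1) : mk U c = mk V c' := by
  unfold mk
  rw [← of_refine hU, ← of_refine hV]
  congr 1
  exact (Submodule.Quotient.eq _).2 ⟨s, hs⟩

open Classical in
/-- The map `f^* : Ȟ¹(X; ℝ) → Ȟ¹(Y; ℝ)` induced by a continuous map `f : Y → X`. -/
def pullback (f : C(Y, X)) : CechH1 X →ₗ[ℝ] CechH1 Y :=
  Module.DirectLimit.lift ℝ (PointedCover X) (fun U => U.H1) PointedCover.refine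
    (fun U => of (U.pullback f) ∘ₗ PointedCover.h1Map f (PointedCover.over_pullback f U))
    (fun U V h a => by
      obtain ⟨c, rfl⟩ := Submodule.Quotient.mk_surjective _ a
      have h' : U.pullback f ≤ V.pullback f := fun y _ hp => h (f y) hp
      rw [LinearMap.comp_apply, LinearMap.comp_apply, ← of_refine h']
      rfl)

/-- The restriction `ξ|_A` of a Čech class to a subspace `A`. -/
def restrict (A : Set X) : CechH1 X →ₗ[ℝ] CechH1 A :=
  pullback ⟨Subtype.val, continuous_subtype_val⟩

end CechH1

/-! ### Continuous closed one-forms -/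

/-- `φ - ψ` is locally constant on `U ∩ V`, for open sets `U` and `V`. -/
def DiffLocallyConstant {X : Type*} [TopologicalSpace X] (p q : Opens X × (X → ℝ)) : Prop :=
  ∀ x, x ∈ p.1 → x ∈ q.1 → ∀ᶠ y in 𝓝 x, p.2 y - q.2 y = p.2 x - q.2 x

/-- A collection `{φ_U}` of continuous functions `φ_U : U → ℝ` on the members of an open cover, with
locally constant differences. A function on `U` is given as a function on `X` whose values
outside `U` are irrelevant (they are ignored by all the definitions below). -/
structure FormData (X : Type*) [TopologicalSpace X] where
  /-- the pairs `(U, φ_U)` -/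
  charts : Set (Opens X × (X → ℝ))
  covers : ∀ x, ∃ p ∈ charts, x ∈ p.1
  continuousOn : ∀ p ∈ charts, ContinuousOn p.2 p.1
  compatible : ∀ p ∈ charts, ∀ q ∈ charts, DiffLocallyConstant p q

theorem DiffLocallyConstant.symm {X : Type*} [TopologicalSpace X] {p q : Opens X × (X → ℝ)}
    (h : DiffLocallyConstant p q) : DiffLocallyConstant q p := by
  intro x hq hp
  filter_upwards [h x hp hq] with y hy
  linarith

namespace FormData

variable {X Y : Type*} [TopologicalSpace X] [TopologicalSpace Y]

/-- Two collections are equivalent if their union has locally constant differences. -/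
instance setoid (X : Type*) [TopologicalSpace X] : Setoid (FormData X) where
  r φ ψ := ∀ p ∈ φ.charts ∪ ψ.charts, ∀ q ∈ φ.charts ∪ ψ.charts, DiffLocallyConstant p q
  iseqv :=
    { refl := fun φ p hp q hq => φ.compatible p (by simpa using hp) q (by simpa using hq)
      symm := fun h p hp q hq => h p (union_comm _ _ ▸ hp) q (union_comm _ _ ▸ hq)
      trans := by
        intro φ ψ χ h₁ h₂
        have key : ∀ p ∈ φ.charts, ∀ q ∈ χ.charts, DiffLocallyConstant p q := by
          intro p hp q hq x hxp hxq
          obtain ⟨r, hr, hxr⟩ := ψ.covers x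
          filter_upwards [h₁ p (.inl hp) r (.inr hr) x hxp hxr,
            h₂ r (.inl hr) q (.inr hq) x hxr hxq] with y h1 h2
          linarith
        rintro p (hp | hp) q (hq | hq)
        · exact φ.compatible p hp q hq
        · exact key p hp q hq
        · exact (key q hq p hp).symm
        · exact χ.compatible p hp q hq }

theorem equiv_diff {φ ψ : FormData X} (h : φ ≈ ψ) {p q : Opens X × (X → ℝ)}
    (hp : p ∈ φ.charts) (hq : q ∈ ψ.charts) : DiffLocallyConstant p q :=
  h p (.inl hp) q (.inr hq)

/-- The collection consisting of the single function `f` on `X`. -/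
def single (f : C(X, ℝ)) : FormData X where
  charts := {((⊤ : Opens X), (f : X → ℝ))}
  covers _ := ⟨_, rfl, trivial⟩
  continuousOn := by
    rintro p rfl
    exact f.continuous.continuousOn
  compatible := by
    rintro p rfl q rfl x - -
    simp

/-- The collection of the functions `φ_U ∘ h : h⁻¹(U) → ℝ`. -/
def pullback (h : C(Y, X)) (φ : FormData X) : FormData Y where
  charts := (fun p => (p.1.comap h, p.2 ∘ h)) '' φ.charts
  covers y := by
    obtain ⟨p, hp, hy⟩ := φ.covers (h y)
    exact ⟨_, ⟨p, hp, rfl⟩, hy⟩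
  continuousOn := by
    rintro _ ⟨p, hp, rfl⟩
    exact (φ.continuousOn p hp).comp h.continuous.continuousOn (fun _ hx => hx)
  compatible := by
    rintro _ ⟨p, hp, rfl⟩ _ ⟨q, hq, rfl⟩ y hyp hyq
    exact h.continuous.continuousAt.eventually (φ.compatible p hp q hq (h y) hyp hyq)

theorem pullback_equiv (h : C(Y, X)) {φ ψ : FormData X} (e : φ ≈ ψ) :
    φ.pullback h ≈ ψ.pullback h := by
  intro p hp q hq y hyp hyq
  have key : ∀ r ∈ (φ.pullback h).charts ∪ (ψ.pullback h).charts,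
      ∃ r' ∈ φ.charts ∪ ψ.charts, (r'.1.comap h, r'.2 ∘ h) = r := by
    rintro r (⟨r', hr, rfl⟩ | ⟨r', hr, rfl⟩)
    · exact ⟨r', .inl hr, rfl⟩
    · exact ⟨r', .inr hr, rfl⟩
  obtain ⟨p', hp', rfl⟩ := key p hp
  obtain ⟨q', hq', rfl⟩ := key q hq
  exact h.continuous.continuousAt.eventually (e p' hp' q' hq' (h y) hyp hyq)

/-! #### The Čech class -/

/-- A member of the collection around the point `x`. -/
def chartAt (φ : FormData X) (x : X) : Opens X × (X → ℝ) := (φ.covers x).choose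

theorem chartAt_mem (φ : FormData X) (x : X) : φ.chartAt x ∈ φ.charts := (φ.covers x).choose_spec.1

theorem mem_chartAt (φ : FormData X) (x : X) : x ∈ (φ.chartAt x).1 := (φ.covers x).choose_spec.2

/-- A cover subordinate to the cover of the collection. -/
def cover (φ : FormData X) : PointedCover X where
  nhd x := (φ.chartAt x).1
  mem_nhd := φ.mem_chartAt

/-- The difference of two functions with locally constant difference, on an open set contained in
the domains of both. -/
def diff (p q : Opens X × (X → ℝ)) (h : DiffLocallyConstant p q) (W : Opens X) (h₁ : W ≤ p.1)
    (h₂ : W ≤ q.1) : LocallyConstant W ℝ where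
  toFun x := p.2 x - q.2 x
  isLocallyConstant := (IsLocallyConstant.iff_eventually_eq _).2 fun x =>
    continuous_subtype_val.continuousAt.eventually (h x.1 (h₁ x.2) (h₂ x.2))

/-- The cocycle `c_{xy} = φ_y - φ_x` of differences. -/
def cocycle (φ : FormData X) : φ.cover.Z1 :=
  ⟨fun x y => diff (φ.chartAt y) (φ.chartAt x)
    (φ.compatible _ (φ.chartAt_mem y) _ (φ.chartAt_mem x)) _ inf_le_right inf_le_left, by
    rw [LinearMap.mem_ker]
    funext x y z
    ext p
    change ((φ.chartAt z).2 p.1 - (φ.chartAt y).2 p.1) - ((φ.chartAt z).2 p.1 - (φ.chartAt x).2 p.1)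
      + ((φ.chartAt y).2 p.1 - (φ.chartAt x).2 p.1) = 0
    ring⟩

/-- The Čech class of a collection. -/
def cechClass (φ : FormData X) : CechH1 X := CechH1.mk φ.cover φ.cocycle

theorem cechClass_eq {φ ψ : FormData X} (e : φ ≈ ψ) : φ.cechClass = ψ.cechClass := by
  let W : PointedCover X :=
    { nhd := fun x => φ.cover.nhd x ⊓ ψ.cover.nhd x
      mem_nhd := fun x => ⟨φ.cover.mem_nhd x, ψ.cover.mem_nhd x⟩ }
  refine CechH1.mk_eq_mk (W := W) (fun x => inf_le_left) (fun x => inf_le_right) _ _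
    (fun x => diff (φ.chartAt x) (ψ.chartAt x)
      (equiv_diff e (φ.chartAt_mem x) (ψ.chartAt_mem x)) _ inf_le_left inf_le_right) ?_
  funext x y
  ext p
  change ((φ.chartAt y).2 p.1 - (ψ.chartAt y).2 p.1) - ((φ.chartAt x).2 p.1 - (ψ.chartAt x).2 p.1)
    = ((φ.chartAt y).2 p.1 - (φ.chartAt x).2 p.1) - ((ψ.chartAt y).2 p.1 - (ψ.chartAt x).2 p.1)
  ring

/-! #### The line integral -/

/-- `I` is the value of the sum
`∑ i, φ_{U_i}(γ(t_{i+1})) - φ_{U_i}(γ(t_i))` for some subdivision `0 = t_0 ≤ ... ≤ t_N = 1` and some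
`(U_i, φ_{U_i})` in the collection with `γ([t_i, t_{i+1}]) ⊆ U_i`. -/
def IsLineIntegral (φ : FormData X) (γ : C(unitInterval, X)) (I : ℝ) : Prop :=
  ∃ (N : ℕ) (t : ℕ → unitInterval) (c : ℕ → Opens X × (X → ℝ)),
    t 0 = 0 ∧ t N = 1 ∧ Monotone t ∧
    (∀ i < N, c i ∈ φ.charts ∧ ∀ s ∈ Icc (t i) (t (i + 1)), γ s ∈ (c i).1) ∧
    I = ∑ i ∈ Finset.range N, ((c i).2 (γ (t (i + 1))) - (c i).2 (γ (t i)))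

theorem exists_isLineIntegral (φ : FormData X) (γ : C(unitInterval, X)) :
    ∃ I, φ.IsLineIntegral γ I := by
  obtain ⟨t, h0, hmono, ⟨N, hN⟩, hc⟩ := exists_monotone_Icc_subset_open_cover_unitInterval
    (c := fun p : φ.charts => γ ⁻¹' p.1.1) (fun p => p.1.1.isOpen.preimage γ.continuous)
    (fun s _ => by
      obtain ⟨p, hp, hs⟩ := φ.covers (γ s)
      exact mem_iUnion.2 ⟨⟨p, hp⟩, hs⟩)
  choose c hc using hc
  exact ⟨_, N, t, fun i => (c i).1, h0, hN N le_rfl, hmono,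
    fun i _ => ⟨(c i).2, fun s hs => hc i hs⟩, rfl⟩

/-- A line integral extends to a primitive of the pull-back of the form to the interval. -/
theorem IsLineIntegral.exists_primitive {φ : FormData X} {γ : C(unitInterval, X)} {I : ℝ}
    (hI : φ.IsLineIntegral γ I) : ∃ G : unitInterval → ℝ, G 0 = 0 ∧ G 1 = I ∧
      ∀ s, ∀ p ∈ φ.charts, γ s ∈ p.1 →
        ∀ᶠ s' in 𝓝 s, G s' - G s = p.2 (γ s') - p.2 (γ s) := by
  obtain ⟨N, t, c, h0, h1, hm, hc, rfl⟩ := hI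
  -- the projection to the `i`-th interval of the subdivision
  let κ : ℕ → unitInterval → unitInterval := fun i s => max (t i) (min s (t (i + 1)))
  have hκ : ∀ i, Continuous (κ i) := fun i => by fun_prop
  have hκm : ∀ i s, κ i s ∈ Icc (t i) (t (i + 1)) := fun i s =>
    ⟨le_max_left _ _, max_le (hm (Nat.le_succ i)) (min_le_right _ _)⟩
  refine ⟨fun s => ∑ i ∈ Finset.range N, ((c i).2 (γ (κ i s)) - (c i).2 (γ (t i))), ?_, ?_, ?_⟩
  · refine Finset.sum_eq_zero fun i _ => ?_
    have : κ i 0 = t i := by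
      simp only [κ]
      rw [min_eq_left (unitInterval.nonneg' ), max_eq_left (unitInterval.nonneg')]
    rw [this, sub_self]
  · refine Finset.sum_congr rfl fun i _ => ?_
    have : κ i 1 = t (i + 1) := by
      simp only [κ]
      rw [min_eq_right (unitInterval.le_one'), max_eq_right (hm (Nat.le_succ i))]
    rw [this]
  · intro s p hp hs
    have hterm : ∀ i ∈ Finset.range N, ∀ᶠ s' in 𝓝 s,
        (c i).2 (γ (κ i s')) - (c i).2 (γ (κ i s)) = p.2 (γ (κ i s')) - p.2 (γ (κ i s)) := by
      intro i hi
      obtain ⟨hci, hsub⟩ := hc i (Finset.mem_range.1 hi)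
      rcases lt_or_ge s (t i) with hlt | hge
      · filter_upwards [Iio_mem_nhds hlt] with s' hs'
        have e : ∀ r < t i, κ i r = t i := fun r hr =>
          max_eq_left ((min_le_left _ _).trans hr.le)
        rw [e s' hs', e s hlt]; simp
      rcases lt_or_ge (t (i + 1)) s with hlt | hle
      · filter_upwards [Ioi_mem_nhds hlt] with s' hs'
        have e : ∀ r, t (i + 1) < r → κ i r = max (t i) (t (i + 1)) := fun r hr => by
          simp only [κ]
          rw [min_eq_right hr.le]
        rw [e s' hs', e s hlt]; simp
      · have e : κ i s = s := by
          simp only [κ]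
          rw [min_eq_left hle, max_eq_right hge]
        have hd := φ.compatible _ hci p hp (γ s) (hsub s ⟨hge, hle⟩) hs
        have hcont : Tendsto (fun s' => γ (κ i s')) (𝓝 s) (𝓝 (γ s)) := by
          have := (γ.continuous.comp (hκ i)).tendsto s
          simpa only [Function.comp_def, e] using this
        filter_upwards [hcont.eventually hd] with s' hs'
        rw [e]
        linarith
    have tele : ∀ r, ∑ i ∈ Finset.range N, (p.2 (γ (κ i r)) - p.2 (γ (t i)))
        = p.2 (γ r) - p.2 (γ 0) := by
      intro r
      have : ∀ i, p.2 (γ (κ i r)) - p.2 (γ (t i))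
          = p.2 (γ (min r (t (i + 1)))) - p.2 (γ (min r (t i))) := by
        intro i
        simp only [κ]
        have hi := hm (Nat.le_succ i)
        rcases le_total r (t i) with h | h
        · rw [min_eq_left h, min_eq_left (h.trans hi), max_eq_left h]; simp
        · rw [min_eq_right h, max_eq_right (le_min h hi)]
      rw [Finset.sum_congr rfl fun i _ => this i,
        Finset.sum_range_sub (fun i => p.2 (γ (min r (t i)))), h0, h1,
        min_eq_left unitInterval.le_one', min_eq_right unitInterval.nonneg']
    filter_upwards [(Finset.eventually_all (Finset.range N)).2 hterm] with s' hs'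
    have a := tele s'
    have b := tele s
    rw [← Finset.sum_sub_distrib]
    have : p.2 (γ s') - p.2 (γ s) = ∑ i ∈ Finset.range N,
        ((p.2 (γ (κ i s')) - p.2 (γ (t i))) - (p.2 (γ (κ i s)) - p.2 (γ (t i)))) := by
      rw [Finset.sum_sub_distrib, a, b]; ring
    rw [this]
    refine Finset.sum_congr rfl fun i hi => ?_
    linarith [hs' i hi]

theorem IsLineIntegral.unique {φ ψ : FormData X} (e : φ ≈ ψ) {γ : C(unitInterval, X)} {I J : ℝ}
    (hI : φ.IsLineIntegral γ I) (hJ : ψ.IsLineIntegral γ J) : I = J := by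
  obtain ⟨G, G0, G1, hG⟩ := hI.exists_primitive
  obtain ⟨H, H0, H1, hH⟩ := hJ.exists_primitive
  have : IsLocallyConstant (fun s => G s - H s) := by
    refine (IsLocallyConstant.iff_eventually_eq _).2 fun s => ?_
    obtain ⟨p, hp, hsp⟩ := φ.covers (γ s)
    obtain ⟨q, hq, hsq⟩ := ψ.covers (γ s)
    filter_upwards [hG s p hp hsp, hH s q hq hsq,
      γ.continuous.continuousAt.eventually (equiv_diff e hp hq (γ s) hsp hsq)] with s' a b c
    linarith
  have := this.apply_eq_of_preconnectedSpace 0 1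
  simp only [G0, H0, G1, H1] at this
  linarith

/-- The line integral of a collection along a path. -/
def lineIntegral (φ : FormData X) (γ : C(unitInterval, X)) : ℝ :=
  (φ.exists_isLineIntegral γ).choose

theorem isLineIntegral_lineIntegral (φ : FormData X) (γ : C(unitInterval, X)) :
    φ.IsLineIntegral γ (φ.lineIntegral γ) :=
  (φ.exists_isLineIntegral γ).choose_spec

end FormData

/-- Continuous closed one-forms on a topological space. -/
def ClosedOneForm (X : Type*) [TopologicalSpace X] : Type _ := Quotient (FormData.setoid X)

namespace ClosedOneForm

variable {X Y : Type*} [TopologicalSpace X] [TopologicalSpace Y]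

/-- The differential `df` of a continuous function `f`. -/
def differential (f : C(X, ℝ)) : ClosedOneForm X := Quotient.mk _ (FormData.single f)

/-- The pull-back `h^* ω`. -/
def pullback (h : C(Y, X)) : ClosedOneForm X → ClosedOneForm Y :=
  Quotient.map (FormData.pullback h) (fun _ _ e => FormData.pullback_equiv h e)

/-- The restriction `ω|_A` to a subspace `A`. -/
def restrict (A : Set X) : ClosedOneForm X → ClosedOneForm A :=
  pullback ⟨Subtype.val, continuous_subtype_val⟩

/-- The Čech cohomology class `[ω] ∈ Ȟ¹(X; ℝ)`: the connecting homomorphism of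
`0 → ℝ_X → C_X → C_X / ℝ_X → 0`. -/
def cechClass : ClosedOneForm X → CechH1 X :=
  Quotient.lift FormData.cechClass (fun _ _ e => FormData.cechClass_eq e)

/-- The line integral of a continuous closed one-form along a path. -/
def lineIntegral (ω : ClosedOneForm X) (γ : C(unitInterval, X)) : ℝ :=
  Quotient.lift (fun φ : FormData X => φ.lineIntegral γ)
    (fun φ ψ e => FormData.IsLineIntegral.unique e (φ.isLineIntegral_lineIntegral γ)
      (ψ.isLineIntegral_lineIntegral γ)) ω

end ClosedOneForm

/-! ### Flows -/

/-- The trajectory from `x` to `x · t`, as a path parametrized by `[0, 1]`. -/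
def Flow.trajectory {X : Type*} [TopologicalSpace X] (Φ : Flow ℝ X) (x : X) (t : ℝ) :
    C(unitInterval, X) where
  toFun s := Φ (s * t) x
  continuous_toFun := Φ.continuous (by fun_prop) continuous_const

/-- There is a `(δ, T)`-chain from `x` to `y`: points `x = x_0, x_1, ..., x_N = y` with `N ≥ 1` and
times `t_1, ..., t_N ≥ T` such that `d(x_{i-1} · t_i, x_i) < δ`. -/
def Flow.HasChain {X : Type*} [MetricSpace X] (Φ : Flow ℝ X) (δ T : ℝ) (x y : X) : Prop :=
  ∃ (N : ℕ) (p : ℕ → X) (t : ℕ → ℝ), 1 ≤ N ∧ p 0 = x ∧ p N = y ∧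
    ∀ i ∈ Finset.Icc 1 N, T ≤ t i ∧ dist (Φ (t i) (p (i - 1))) (p i) < δ

/-- The chain recurrent set `R(Φ)`. -/
def Flow.chainRecurrentSet {X : Type*} [MetricSpace X] (Φ : Flow ℝ X) : Set X :=
  {x | ∀ δ > 0, ∀ T ≥ 1, Φ.HasChain δ T x x}

/-- `ω` is a Lyapunov one-form for the pair `(Φ, Y)`, where `Y` is a closed invariant set. -/
structure IsLyapunovOneForm {X : Type*} [TopologicalSpace X] (Φ : Flow ℝ X) (Y : Set X)
    (ω : ClosedOneForm X) : Prop where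
  isClosed : IsClosed Y
  isInvariant : IsInvariant Φ Y
  integral_neg : ∀ x ∉ Y, ∀ t > 0, ω.lineIntegral (Φ.trajectory x t) < 0
  exact_near : ∃ U : Set X, IsOpen U ∧ Y ⊆ U ∧ ∃ f : C(U, ℝ),
    ω.restrict U = ClosedOneForm.differential f ∧
    ∀ a b : U, a.1 ∈ Y → b.1 ∈ connectedComponentIn Y a.1 → f a = f b

end

/-! The form is built as a closed form trivial near the chain recurrent set `R`, corrected by a
large multiple of a Lyapunov function and then averaged over unit time.

Conley's argument (`exists_lyapunov_function`) gives a continuous `L` that strictly decreases in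
time one off `R` and is constant on connected subsets of `R`. It is a weighted sum of functions with
values in `{0, 1}` on `R`, obtained from sets of points reachable by chains.

A partition of unity represents `ξ` by a form (`exists_cechClass_eq`). Since `ξ` dies on the closed
set `R`, the form has a primitive on `R`. It extends to a neighbourhood, and subtracting the
differential of a global extension leaves a form `φ` of class `ξ` that vanishes near `R`
(`exists_vanishesOn_of_restrict_eq_zero`).

By compactness, for large `r` the integral of `φ + r dL` over every unit-time trajectory off `R` is
negative (`exists_mul_dominates`). This says nothing about short times. Put `B(s) = ∫_x^{x·s} φ + r
L(x·s)` and `h(x) = ∫₀¹ B`; then the integral of `φ + dh` from `x` to `x·t` is `∫₀ᵗ (B(s+1) - B(s))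
ds`, an integral of those negative unit-time quantities (`lineIntegral_average`). Adding `dh` does
not change the class, near `R` the form is `dh`, and `h = r L` on `R`. -/

/-! ### Chains and a complete Lyapunov function of a flow -/

namespace Flow

variable {X : Type*} [MetricSpace X] (Φ : Flow ℝ X)

/-- `b` is `δ`-close to a point of the trajectory of `a` at some time at least `T`. -/
def ChainStep (δ T : ℝ) (a b : X) : Prop := ∃ t, T ≤ t ∧ dist (Φ t a) b < δ

theorem HasChain.transGen {Φ : Flow ℝ X} {δ T : ℝ} {x y : X} (h : Φ.HasChain δ T x y) :
    Relation.TransGen (Φ.ChainStep δ T) x y := by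
  obtain ⟨N, p, t, hN, rfl, rfl, hp⟩ := h
  have step : ∀ i, i < N → Φ.ChainStep δ T (p i) (p (i + 1)) := fun i hi =>
    ⟨t (i + 1), by simpa using hp (i + 1) (by simp; omega)⟩
  have : ∀ i, i < N → Relation.TransGen (Φ.ChainStep δ T) (p 0) (p (i + 1)) := by
    intro i
    induction i with
    | zero => exact fun hi => .single (step 0 hi)
    | succ i ih => exact fun hi => (ih (by omega)).tail (step _ hi)
  obtain ⟨n, rfl⟩ : ∃ n, N = n + 1 := ⟨N - 1, by omega⟩
  exact this n (by omega)

theorem hasChain_of_transGen {Φ : Flow ℝ X} {δ T : ℝ} {x y : X}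
    (h : Relation.TransGen (Φ.ChainStep δ T) x y) : Φ.HasChain δ T x y := by
  induction h with
  | @single b h =>
    obtain ⟨t, ht, hd⟩ := h
    refine ⟨1, fun i => if i = 0 then x else b, fun _ => t, le_rfl, by simp, by simp, ?_⟩
    intro i hi
    obtain rfl : i = 1 := by simpa using hi
    simpa using ⟨ht, hd⟩
  | @tail b c _ h ih =>
    obtain ⟨t, ht, hd⟩ := h
    obtain ⟨N, p, s, hN, h0, hNb, hp⟩ := ih
    refine ⟨N + 1, fun i => if i ≤ N then p i else c, fun i => if i ≤ N then s i else t,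
      by omega, by simpa using h0, by simp, ?_⟩
    intro i hi
    rw [Finset.mem_Icc] at hi
    rcases Nat.lt_or_ge N i with hlt | hle
    · obtain rfl : i = N + 1 := by omega
      simpa [hNb] using ⟨ht, hd⟩
    · have := hp i (Finset.mem_Icc.2 ⟨hi.1, hle⟩)
      have hle' : i - 1 ≤ N := by omega
      simpa [hle, hle'] using this

theorem hasChain_iff_transGen {Φ : Flow ℝ X} {δ T : ℝ} {x y : X} :
    Φ.HasChain δ T x y ↔ Relation.TransGen (Φ.ChainStep δ T) x y :=
  ⟨HasChain.transGen, hasChain_of_transGen⟩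

/-- Only the last step matters: its endpoint ranges over a union of open balls. -/
theorem isOpen_setOf_transGen_chainStep (δ T : ℝ) (x : X) :
    IsOpen {y | Relation.TransGen (Φ.ChainStep δ T) x y} := by
  have hball : ∀ a, IsOpen {y | Φ.ChainStep δ T a y} := by
    intro a
    have : {y | Φ.ChainStep δ T a y} = ⋃ t ∈ Ici T, Metric.ball (Φ t a) δ := by
      ext y
      simp [ChainStep, dist_comm]
    rw [this]
    exact isOpen_biUnion fun _ _ => Metric.isOpen_ball
  have : {y | Relation.TransGen (Φ.ChainStep δ T) x y} =
      ⋃ a ∈ {a | Relation.ReflTransGen (Φ.ChainStep δ T) x a}, {y | Φ.ChainStep δ T a y} := by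
    ext y
    simp only [mem_ofPred_eq, mem_iUnion, exists_prop]
    exact Relation.TransGen.tail'_iff
  rw [this]
  exact isOpen_biUnion fun a _ => hball a

/-- `Φ s` commutes with the flow and is uniformly continuous, so it carries `δ'`-chains to
`δ`-chains with the same times. -/
theorem isInvariant_chainRecurrentSet [CompactSpace X] :
    IsInvariant Φ Φ.chainRecurrentSet := by
  intro s x hx δ hδ T hT
  have huc : UniformContinuous (Φ s) :=
    CompactSpace.uniformContinuous_of_continuous (Φ.continuous continuous_const continuous_id)
  obtain ⟨δ', hδ', h⟩ := Metric.uniformContinuous_iff.1 huc δ hδ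
  have hc := hx δ' hδ' T hT
  rw [hasChain_iff_transGen] at hc ⊢
  refine hc.lift (Φ s) ?_
  rintro a b ⟨t, ht, hd⟩
  refine ⟨t, ht, ?_⟩
  have := h hd
  rwa [← Φ.map_add, add_comm, Φ.map_add] at this

/-- For a point `x` without `(ε, T)`-chain back to itself, there is a continuous function which
does not increase in time one, takes only the values `0` and `1` on the chain recurrent set, and
separates `x` from the far future of its trajectory. -/
theorem exists_monotone_function_of_not_hasChain (x : X) {ε T : ℝ} (hε : 0 < ε) (hT : 1 ≤ T)
    (hx : ¬ Φ.HasChain ε T x x) :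
    ∃ m : C(X, ℝ), (∀ y, 0 ≤ m y ∧ m y ≤ 1) ∧ (∀ y, m (Φ 1 y) ≤ m y) ∧
      (∀ y ∈ Φ.chainRecurrentSet, m y = 0 ∨ m y = 1) ∧ m x = 1 ∧ ∃ n : ℕ, m (Φ n x) = 0 := by
  rw [hasChain_iff_transGen] at hx
  set N : Set X := {y | Relation.TransGen (Φ.ChainStep ε T) x y} with hNdef
  have hNo : IsOpen N := Φ.isOpen_setOf_transGen_chainStep ε T x
  have hstep : ∀ y ∈ N, ∀ t, T ≤ t → ∀ z, dist (Φ t y) z < ε → z ∈ N := fun y hy t ht z hz =>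
    Relation.TransGen.tail hy ⟨t, ht, hz⟩
  have hxN : ∀ t, T ≤ t → Φ t x ∈ N := fun t ht =>
    Relation.TransGen.single ⟨t, ht, by simpa using hε⟩
  -- `S` is forward invariant and its `ε`-neighbourhood lies in `N`. Hence `v` below is `0` on the
  -- closure of `S` and `1` off `N`, and the supremum along integer times makes it monotone.
  set S : Set X := {z | ∃ y ∈ N, ∃ t, T ≤ t ∧ Φ t y = z} with hSdef
  have hSne : S.Nonempty := ⟨_, _, hxN T le_rfl, T, le_rfl, rfl⟩
  have hSN : ∀ z ∉ N, ε ≤ Metric.infDist z S := by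
    intro z hz
    refine (Metric.le_infDist hSne).2 ?_
    rintro _ ⟨y, hy, t, ht, rfl⟩
    by_contra! hlt
    exact hz (hstep y hy t ht z (by rwa [dist_comm]))
  have hSinv : ∀ z ∈ S, ∀ s, 0 ≤ s → Φ s z ∈ S := by
    rintro _ ⟨y, hy, t, ht, rfl⟩ s hs
    exact ⟨y, hy, s + t, by linarith, Φ.map_add _ _ _⟩
  have hSinv' : ∀ z ∈ closure S, ∀ s, 0 ≤ s → Φ s z ∈ closure S := fun z hz s hs =>
    map_mem_closure (Φ.continuous continuous_const continuous_id) hz (fun w hw => hSinv w hw s hs)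
  let v : X → ℝ := fun z => min 1 (Metric.infDist z S / ε)
  have hvc : Continuous v := continuous_const.min ((Metric.continuous_infDist_pt S).div_const ε)
  have hv0 : ∀ z, 0 ≤ v z := fun z => le_min zero_le_one (div_nonneg Metric.infDist_nonneg hε.le)
  have hv1 : ∀ z, v z ≤ 1 := fun z => min_le_left _ _
  have hvN : ∀ z ∉ N, v z = 1 := fun z hz =>
    min_eq_left ((one_le_div hε).2 (hSN z hz))
  have hvS : ∀ z ∈ closure S, v z = 0 := by
    intro z hz
    simp [v, (Metric.mem_closure_iff_infDist_zero hSne).1 hz]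
  let m : X → ℝ := fun y => ⨆ k : ℕ, v (Φ k y)
  have hbdd : ∀ y, BddAbove (range fun k : ℕ => v (Φ k y)) := by
    rintro y
    refine ⟨1, ?_⟩
    rintro _ ⟨k, rfl⟩
    exact hv1 _
  have hle : ∀ y (k : ℕ), v (Φ k y) ≤ m y := fun y k => le_ciSup (hbdd y) k
  have hvm : ∀ y, v y ≤ m y := fun y => by simpa using hle y 0
  have hm1 : ∀ y, m y ≤ 1 := fun y => ciSup_le fun k => hv1 _
  have hmS : ∀ z ∈ closure S, m z = 0 := by
    intro z hz
    refine le_antisymm (ciSup_le fun k => (hvS _ (hSinv' z hz k k.cast_nonneg)).le) ?_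
    exact (hv0 z).trans (hvm z)
  have hmN : ∀ z ∉ N, m z = 1 := fun z hz =>
    le_antisymm (hm1 z) ((hvN z hz).symm.le.trans (hvm z))
  have hmc : Continuous m := by
    rw [continuous_iff_continuousAt]
    intro y
    -- On the open set `N` the terms with `k ≥ T` vanish, so `m` is locally a finite maximum. Off
    -- `N` it is squeezed between `v` and `1`, which agree at `y`.
    by_cases hy : y ∈ N
    · obtain ⟨K, hK⟩ := exists_nat_ge T
      have hne : (Finset.range (K + 1)).Nonempty := ⟨0, by simp⟩
      have hg : Continuous fun z => (Finset.range (K + 1)).sup' hne fun k : ℕ => v (Φ k z) :=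
        Continuous.finset_sup'_apply hne fun k _ =>
          hvc.comp (Φ.continuous continuous_const continuous_id)
      refine hg.continuousAt.congr ?_
      filter_upwards [hNo.mem_nhds hy] with z hz
      refine le_antisymm (Finset.sup'_le _ _ fun k _ => hle z k) (ciSup_le fun k => ?_)
      by_cases hk : k ≤ K
      · exact Finset.le_sup' (fun k : ℕ => v (Φ k z)) (Finset.mem_range.2 (by omega))
      · have : T ≤ (k : ℝ) := hK.trans (by exact_mod_cast (not_le.1 hk).le)
        rw [hvS _ (subset_closure ⟨z, hz, k, this, rfl⟩)]
        exact (hv0 (Φ (0 : ℕ) z)).trans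
          (Finset.le_sup' (fun k : ℕ => v (Φ k z)) (Finset.mem_range.2 (by omega)))
    · have h1 : Tendsto v (𝓝 y) (𝓝 (m y)) := by
        rw [hmN y hy, ← hvN y hy]
        exact hvc.tendsto y
      have h2 : Tendsto (fun _ : X => (1 : ℝ)) (𝓝 y) (𝓝 (m y)) := by
        rw [hmN y hy]
        exact tendsto_const_nhds
      exact tendsto_of_tendsto_of_tendsto_of_le_of_le h1 h2 hvm hm1
  refine ⟨⟨m, hmc⟩, fun y => ⟨(hv0 y).trans (hvm y), hm1 y⟩, ?_, ?_, hmN x hx, ?_⟩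
  · intro y
    refine ciSup_le fun k => ?_
    have := hle y (k + 1)
    rw [Nat.cast_succ, Φ.map_add] at this
    exact this
  · intro y hy
    by_cases hyN : y ∈ N
    · refine Or.inl (hmS y ?_)
      rw [Metric.mem_closure_iff]
      intro δ hδ
      -- Jumps below `ε` keep the chain in `N`; the last jump, below `δ`, puts `y` within `δ` of a
      -- point of `S`.
      have hc := (hy (min δ ε) (lt_min hδ hε) (2 * T) (by linarith)).transGen
      obtain ⟨u, hu, t, ht, hd⟩ := Relation.TransGen.tail'_iff.1 hc
      have huN : u ∈ N := by
        clear hd ht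
        induction hu with
        | refl => exact hyN
        | tail _ h ih =>
          obtain ⟨s, hs, hd⟩ := h
          exact hstep _ ih s (by linarith) _ (hd.trans_le (min_le_right _ _))
      exact ⟨Φ t u, ⟨u, huN, t, by linarith, rfl⟩,
        by rw [dist_comm]; exact hd.trans_le (min_le_left _ _)⟩
    · exact Or.inr (hmN y hyN)
  · obtain ⟨K, hK⟩ := exists_nat_ge T
    -- The first `K` units of time lead from `x` into `N`, the next `K` from `N` into `S`.
    refine ⟨K + K, hmS _ (subset_closure ⟨Φ K x, hxN K hK, K, hK, ?_⟩)⟩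
    rw [Nat.cast_add, Φ.map_add]

/-- Since `m` falls from `1` to `0` along the integer orbit of `x`, it drops strictly at some step
`k`. Precomposing with `Φ k` moves that drop to `x`; invariance preserves the values on the chain
recurrent set. -/
theorem exists_monotone_function_strict (x : X) (hinv : IsInvariant Φ Φ.chainRecurrentSet)
    (hx : x ∉ Φ.chainRecurrentSet) :
    ∃ m : C(X, ℝ), (∀ y, 0 ≤ m y ∧ m y ≤ 1) ∧ (∀ y, m (Φ 1 y) ≤ m y) ∧
      (∀ y ∈ Φ.chainRecurrentSet, m y = 0 ∨ m y = 1) ∧ m (Φ 1 x) < m x := by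
  simp only [chainRecurrentSet, mem_ofPred_eq, not_forall] at hx
  obtain ⟨ε, hε, T, hT, hx⟩ := hx
  obtain ⟨m, h01, hmono, hR, hx1, n, hn⟩ :=
    Φ.exists_monotone_function_of_not_hasChain x hε hT hx
  obtain ⟨k, hk⟩ : ∃ k : ℕ, m (Φ (k + 1 : ℕ) x) < m (Φ k x) := by
    by_contra! h
    have : ∀ k : ℕ, 1 ≤ m (Φ k x) := by
      intro k
      induction k with
      | zero => simp [hx1]
      | succ k ih => exact ih.trans (h k)
    linarith [this n]
  refine ⟨m.comp ⟨Φ k, Φ.continuous continuous_const continuous_id⟩, fun y => h01 _, ?_,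
    fun y hy => hR _ (hinv k hy), ?_⟩
  · intro y
    have := hmono (Φ k y)
    rwa [← Φ.map_add, add_comm, Φ.map_add] at this
  · rwa [Nat.cast_succ, Φ.map_add] at hk

theorem eq_of_isPreconnected_of_mem_zero_one {m : C(X, ℝ)} {R : Set X}
    (hm : ∀ y ∈ R, m y = 0 ∨ m y = 1) {s : Set X} (hs : s ⊆ R) (hp : IsPreconnected s) {a b : X}
    (ha : a ∈ s) (hb : b ∈ s) : m a = m b := by
  have hd : IsDiscrete ({0, 1} : Set ℝ) := (Set.toFinite _).isDiscrete
  obtain ⟨y, -, hy⟩ := hp.eqOn_const_of_mapsTo hd m.continuous.continuousOn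
    (fun z hz => hm z (hs hz)) ⟨0, by simp⟩
  exact (hy ha).trans (hy hb).symm

theorem isPreconnected_range_orbit (x : X) : IsPreconnected (range fun t : ℝ => Φ t x) :=
  isPreconnected_range (Φ.continuous continuous_id continuous_const)

/-- A strict drop in time one is an open condition. It never occurs at a chain recurrent point,
whose connected orbit stays where `m` takes only the values `0` and `1`. -/
theorem isClosed_chainRecurrentSet [CompactSpace X] : IsClosed Φ.chainRecurrentSet := by
  rw [← isOpen_compl_iff, isOpen_iff_mem_nhds]
  intro x hx
  obtain ⟨m, -, -, hR, hlt⟩ :=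
    Φ.exists_monotone_function_strict x Φ.isInvariant_chainRecurrentSet hx
  have ho : IsOpen {y | m (Φ 1 y) < m y} :=
    isOpen_lt (m.continuous.comp (Φ.continuous continuous_const continuous_id)) m.continuous
  filter_upwards [ho.mem_nhds hlt] with y hy hyR
  refine (ne_of_lt hy) (eq_of_isPreconnected_of_mem_zero_one hR ?_
    (Φ.isPreconnected_range_orbit y) ⟨1, rfl⟩ ⟨0, by simp⟩)
  rintro _ ⟨t, rfl⟩
  exact Φ.isInvariant_chainRecurrentSet t hyR

/-- Conley's theorem: a complete Lyapunov function. -/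
theorem exists_lyapunov_function [CompactSpace X] :
    ∃ L : C(X, ℝ), (∀ x ∉ Φ.chainRecurrentSet, L (Φ 1 x) < L x) ∧
      ∀ s ⊆ Φ.chainRecurrentSet, IsPreconnected s → ∀ a ∈ s, ∀ b ∈ s, L a = L b := by
  let A : Set C(X, ℝ) := {m | (∀ y, 0 ≤ m y ∧ m y ≤ 1) ∧ (∀ y, m (Φ 1 y) ≤ m y) ∧
      ∀ y ∈ Φ.chainRecurrentSet, m y = 0 ∨ m y = 1}
  have : Nonempty A := ⟨⟨0, by simp [A]⟩⟩
  -- `C(X, ℝ)` is separable for compact metric `X`, and a strict drop at `x` is open in `m`; so some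
  -- term of a dense sequence drops at each `x` off the chain recurrent set.
  let u : ℕ → A := denseSeq A
  let g : ℕ → X → ℝ := fun n x => (1 / 2 : ℝ) ^ n * (u n).1 x
  have hsum : Summable fun n : ℕ => (1 / 2 : ℝ) ^ n := summable_geometric_two
  have hbd : ∀ n x, ‖g n x‖ ≤ (1 / 2 : ℝ) ^ n := by
    intro n x
    obtain ⟨h0, h1⟩ := (u n).2.1 x
    rw [Real.norm_eq_abs, abs_of_nonneg (mul_nonneg (by positivity) h0)]
    exact mul_le_of_le_one_right (by positivity) h1
  have hgs : ∀ x, Summable fun n => g n x := fun x => hsum.of_norm_bounded (hbd · x)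
  refine ⟨⟨fun x => ∑' n, g n x, continuous_tsum (fun n => by fun_prop) hsum hbd⟩, ?_, ?_⟩
  · intro x hx
    obtain ⟨m, h01, hmono, hR, hlt⟩ :=
      Φ.exists_monotone_function_strict x Φ.isInvariant_chainRecurrentSet hx
    have ho : IsOpen {a : A | a.1 (Φ 1 x) < a.1 x} :=
      isOpen_lt ((ContinuousEvalConst.continuous_eval_const _).comp continuous_subtype_val)
        ((ContinuousEvalConst.continuous_eval_const _).comp continuous_subtype_val)
    obtain ⟨n, hn⟩ := (denseRange_denseSeq A).exists_mem_open ho ⟨⟨m, h01, hmono, hR⟩, hlt⟩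
    refine Summable.tsum_lt_tsum (i := n) (fun k => ?_) ?_ (hgs _) (hgs _)
    · exact mul_le_mul_of_nonneg_left ((u k).2.2.1 x) (by positivity)
    · exact mul_lt_mul_of_pos_left hn (by positivity)
  · intro s hs hp a ha b hb
    refine tsum_congr fun n => ?_
    simp only [g]
    rw [eq_of_isPreconnected_of_mem_zero_one (u n).2.2.2 hs hp ha hb]

end Flow

/-! ### Primitives along paths -/

namespace FormData

variable {X : Type*} [TopologicalSpace X]

theorem equiv_of_diff {φ ψ : FormData X}
    (h : ∀ p ∈ φ.charts, ∀ q ∈ ψ.charts, DiffLocallyConstant p q) : φ ≈ ψ := by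
  rintro p (hp | hp) q (hq | hq)
  · exact φ.compatible p hp q hq
  · exact h p hp q hq
  · exact (h q hq p hp).symm
  · exact ψ.compatible p hp q hq

/-- `G` is a primitive of the pull-back of the collection `φ` along the path `γ`. -/
def IsPrimitiveAlong (φ : FormData X) (γ : C(unitInterval, X)) (G : unitInterval → ℝ) : Prop :=
  ∀ s, ∀ p ∈ φ.charts, γ s ∈ p.1 → ∀ᶠ s' in 𝓝 s, G s' - G s = p.2 (γ s') - p.2 (γ s)

/-- Two primitives along a path differ by a locally constant function on the connected unit
interval. -/
theorem IsPrimitiveAlong.lineIntegral_eq {φ : FormData X} {γ : C(unitInterval, X)}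
    {G : unitInterval → ℝ} (hG : φ.IsPrimitiveAlong γ G) : φ.lineIntegral γ = G 1 - G 0 := by
  obtain ⟨H, H0, H1, hH⟩ := (φ.isLineIntegral_lineIntegral γ).exists_primitive
  have : IsLocallyConstant (fun s => G s - H s) := by
    refine (IsLocallyConstant.iff_eventually_eq _).2 fun s => ?_
    obtain ⟨p, hp, hsp⟩ := φ.covers (γ s)
    filter_upwards [hG s p hp hsp, hH s p hp hsp] with s' a b
    linarith
  have := this.apply_eq_of_preconnectedSpace 0 1
  simp only [H0, H1] at this
  linarith

theorem exists_isPrimitiveAlong (φ : FormData X) (γ : C(unitInterval, X)) :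
    ∃ G, φ.IsPrimitiveAlong γ G := by
  obtain ⟨G, -, -, hG⟩ := (φ.isLineIntegral_lineIntegral γ).exists_primitive
  exact ⟨G, hG⟩

theorem IsPrimitiveAlong.comp {φ : FormData X} {γ : C(unitInterval, X)} {G : unitInterval → ℝ}
    (hG : φ.IsPrimitiveAlong γ G) (σ : C(unitInterval, unitInterval)) :
    φ.IsPrimitiveAlong (γ.comp σ) (G ∘ σ) := fun s p hp hs =>
  σ.continuous.continuousAt.eventually (hG (σ s) p hp hs)

theorem lineIntegral_of_isLineIntegral {φ : FormData X} {γ : C(unitInterval, X)} {I : ℝ}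
    (h : φ.IsLineIntegral γ I) : φ.lineIntegral γ = I :=
  IsLineIntegral.unique (Setoid.refl φ) (φ.isLineIntegral_lineIntegral γ) h

/-- The line integral depends continuously on the path, in the compact-open topology. -/
theorem continuous_lineIntegral (φ : FormData X) : Continuous φ.lineIntegral := by
  rw [continuous_iff_continuousAt]
  intro γ
  obtain ⟨N, t, c, h0, h1, hm, hc, hI⟩ := φ.isLineIntegral_lineIntegral γ
  -- The subdivision and charts used for `γ` also serve all nearby paths.
  have hev : ∀ᶠ γ' : C(unitInterval, X) in 𝓝 γ,
      ∀ i ∈ Finset.range N, MapsTo γ' (Icc (t i) (t (i + 1))) (c i).1 := by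
    refine (Finset.eventually_all _).2 fun i hi => ?_
    exact (ContinuousMap.isOpen_setOfPred_mapsTo isCompact_Icc (c i).1.isOpen).mem_nhds
      (fun s hs => (hc i (Finset.mem_range.1 hi)).2 s hs)
  have hcont : ContinuousAt (fun γ' : C(unitInterval, X) => ∑ i ∈ Finset.range N,
      ((c i).2 (γ' (t (i + 1))) - (c i).2 (γ' (t i)))) γ := by
    refine tendsto_finsetSum _ fun i hi => ?_
    obtain ⟨hci, hs⟩ := hc i (Finset.mem_range.1 hi)
    have key : ∀ s ∈ Icc (t i) (t (i + 1)),
        ContinuousAt (fun γ' : C(unitInterval, X) => (c i).2 (γ' s)) γ := fun s hs' =>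
      ContinuousAt.comp (f := fun γ' : C(unitInterval, X) => γ' s)
        ((φ.continuousOn _ hci).continuousAt ((c i).1.isOpen.mem_nhds (hs s hs')))
        (ContinuousEvalConst.continuous_eval_const s).continuousAt
    have hle := hm (Nat.le_succ i)
    exact (key _ ⟨hle, le_rfl⟩).sub (key _ ⟨le_rfl, hle⟩)
  refine hcont.congr ?_
  filter_upwards [hev] with γ' h'
  exact (lineIntegral_of_isLineIntegral ⟨N, t, c, h0, h1, hm, fun i hi =>
    ⟨(hc i hi).1, fun s hs => h' i (Finset.mem_range.2 hi) hs⟩, rfl⟩).symm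

/-- The collection vanishes on the open set `U`: its members are locally constant there. -/
def VanishesOn (φ : FormData X) (U : Set X) : Prop :=
  ∀ p ∈ φ.charts, ∀ x ∈ p.1, x ∈ U → ∀ᶠ y in 𝓝 x, p.2 y = p.2 x

theorem VanishesOn.lineIntegral_eq_zero {φ : FormData X} {U : Set X} (h : φ.VanishesOn U)
    {γ : C(unitInterval, X)} (hγ : ∀ s, γ s ∈ U) : φ.lineIntegral γ = 0 := by
  have : φ.IsPrimitiveAlong γ 0 := fun s p hp hs => by
    filter_upwards [γ.continuous.continuousAt.eventually (h p hp _ hs (hγ s))] with s' hs'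
    simp [hs']
  simp [this.lineIntegral_eq]

/-- The collection `φ + dg`. -/
def addDifferential (φ : FormData X) (g : C(X, ℝ)) : FormData X where
  charts := (fun p => (p.1, fun x => p.2 x + g x)) '' φ.charts
  covers x := by
    obtain ⟨p, hp, hx⟩ := φ.covers x
    exact ⟨_, ⟨p, hp, rfl⟩, hx⟩
  continuousOn := by
    rintro _ ⟨p, hp, rfl⟩
    exact (φ.continuousOn p hp).add g.continuous.continuousOn
  compatible := by
    rintro _ ⟨p, hp, rfl⟩ _ ⟨q, hq, rfl⟩ x hxp hxq
    filter_upwards [φ.compatible p hp q hq x hxp hxq] with y hy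
    simpa using hy

theorem lineIntegral_addDifferential (φ : FormData X) (g : C(X, ℝ)) (γ : C(unitInterval, X)) :
    (φ.addDifferential g).lineIntegral γ = φ.lineIntegral γ + (g (γ 1) - g (γ 0)) := by
  obtain ⟨G, hG⟩ := φ.exists_isPrimitiveAlong γ
  have : (φ.addDifferential g).IsPrimitiveAlong γ (fun s => G s + g (γ s)) := by
    rintro s _ ⟨p, hp, rfl⟩ hs
    filter_upwards [hG s p hp hs] with s' hs'
    linarith
  rw [this.lineIntegral_eq, hG.lineIntegral_eq]
  ring

end FormData

/-! ### Line integrals along trajectories -/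

namespace Flow

variable {X : Type*} [TopologicalSpace X] (Φ : Flow ℝ X)

theorem trajectory_apply (x : X) (t : ℝ) (s : unitInterval) :
    Φ.trajectory x t s = Φ (s * t) x := rfl

theorem continuous_trajectory : Continuous fun q : X × ℝ => Φ.trajectory q.1 q.2 := by
  refine ContinuousMap.continuous_of_continuous_uncurry _ ?_
  exact Φ.continuous (by fun_prop) (by fun_prop)

theorem continuous_lineIntegral_trajectory (φ : FormData X) :
    Continuous fun q : X × ℝ => φ.lineIntegral (Φ.trajectory q.1 q.2) :=
  φ.continuous_lineIntegral.comp Φ.continuous_trajectory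

/-- Both pieces are affine reparametrisations of parts of the long trajectory, so one primitive
along the latter computes all three integrals. -/
theorem lineIntegral_trajectory_add (φ : FormData X) (x : X) {a b : ℝ} (ha : 0 ≤ a) (hb : 0 ≤ b) :
    φ.lineIntegral (Φ.trajectory x (a + b)) =
      φ.lineIntegral (Φ.trajectory x a) + φ.lineIntegral (Φ.trajectory (Φ a x) b) := by
  obtain ⟨G, hG⟩ := φ.exists_isPrimitiveAlong (Φ.trajectory x (a + b))
  -- If `a + b = 0` then `a = 0`, and the default value `0 / 0 = 0` still gives `p * (a + b) = a`.
  let p : ℝ := a / (a + b)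
  have hp0 : 0 ≤ p := by positivity
  have hp1 : p ≤ 1 := div_le_one_of_le₀ (by linarith) (by linarith)
  have hpa : p * (a + b) = a := by
    rcases eq_or_lt_of_le (add_nonneg ha hb) with h | h
    · have : a = 0 := by linarith
      simp [p, this]
    · exact div_mul_cancel₀ _ h.ne'
  let σ : C(unitInterval, unitInterval) :=
    ⟨fun s => ⟨s * p, mul_nonneg s.2.1 hp0, mul_le_one₀ s.2.2 hp0 hp1⟩, by fun_prop⟩
  let τ : C(unitInterval, unitInterval) :=
    ⟨fun s => ⟨p + s * (1 - p), add_nonneg hp0 (mul_nonneg s.2.1 (by linarith)), by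
      nlinarith [s.2.2, s.2.1]⟩, by fun_prop⟩
  have hσ : (Φ.trajectory x (a + b)).comp σ = Φ.trajectory x a := by
    ext s
    change Φ (s * p * (a + b)) x = Φ (s * a) x
    rw [mul_assoc, hpa]
  have hτ : (Φ.trajectory x (a + b)).comp τ = Φ.trajectory (Φ a x) b := by
    ext s
    change Φ ((p + s * (1 - p)) * (a + b)) x = Φ (s * b) (Φ a x)
    rw [← Φ.map_add]
    congr 1
    linear_combination (1 - (s : ℝ)) * hpa
  have h1 := (hG.comp σ).lineIntegral_eq
  have h2 := (hG.comp τ).lineIntegral_eq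
  rw [hσ] at h1
  rw [hτ] at h2
  rw [h1, h2, hG.lineIntegral_eq]
  have e0 : σ 0 = 0 := Subtype.ext (by simp [σ])
  have e1 : σ 1 = τ 0 := Subtype.ext (by simp [σ, τ])
  have e2 : τ 1 = 1 := Subtype.ext (by simp [τ])
  simp only [Function.comp_apply, e0, e1, e2]
  ring

end Flow

/-! ### Čech classes of continuous closed one-forms -/

theorem LocallyConstant.eventually_apply_eq {X Z : Type*} [TopologicalSpace X] {U : Opens X}
    (c : LocallyConstant U Z) (x : U) :
    ∀ᶠ y in 𝓝 (x : X), ∀ hy : y ∈ U, c ⟨y, hy⟩ = c x := by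
  have h := (IsLocallyConstant.iff_eventually_eq _).1 c.isLocallyConstant x
  rw [nhds_induced, eventually_comap] at h
  filter_upwards [h] with y h' hy
  exact h' ⟨y, hy⟩ rfl

namespace PointedCover

variable {X : Type*} [TopologicalSpace X]

instance : Nonempty (PointedCover X) := ⟨⟨fun _ => ⊤, fun _ => trivial⟩⟩

instance : IsDirectedOrder (PointedCover X) where
  directed U V := ⟨⟨fun x => U.nhd x ⊓ V.nhd x, fun x => ⟨U.mem_nhd x, V.mem_nhd x⟩⟩,
    fun _ => inf_le_left, fun _ => inf_le_right⟩

/-- With directedness, this ensures that a class vanishing in the limit already vanishes on some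
finer cover. -/
instance : DirectedSystem (fun U : PointedCover X => U.H1) fun U V h => refine U V h where
  map_self U a := by
    obtain ⟨c, rfl⟩ := Submodule.Quotient.mk_surjective _ a
    rfl
  map_map U V W h h' a := by
    obtain ⟨c, rfl⟩ := Submodule.Quotient.mk_surjective _ a
    rfl

end PointedCover

namespace CechH1

open PointedCover

variable {X : Type*} [TopologicalSpace X]

theorem exists_mk (ξ : CechH1 X) : ∃ (U : PointedCover X) (c : U.Z1), mk U c = ξ := by
  classical
  obtain ⟨U, a, rfl⟩ := Module.DirectLimit.exists_of ξ
  obtain ⟨c, rfl⟩ := Submodule.Quotient.mk_surjective _ a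
  refine ⟨U, c, ?_⟩
  unfold mk of
  congr!

theorem exists_of_mk_eq_zero {U : PointedCover X} {c : U.Z1} (h : mk U c = 0) :
    ∃ (V : PointedCover X) (hV : U ≤ V) (s : V.C0),
      V.d0 s = cochainMap (.id X) (over_id hV) c.1 := by
  classical
  obtain ⟨V, hV, h0⟩ := Module.DirectLimit.of.zero_exact h
  obtain ⟨s, hs⟩ := (Submodule.Quotient.mk_eq_zero _).1 h0
  exact ⟨V, hV, s, hs⟩

theorem restrict_mk (A : Set X) (U : PointedCover X) (c : U.Z1) :
    restrict A (mk U c) = mk (U.pullback ⟨Subtype.val, continuous_subtype_val⟩)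
      (cocycleMap _ (over_pullback _ U) c) := by
  classical
  unfold restrict pullback mk of
  erw [Module.DirectLimit.lift_of]
  rfl

end CechH1

namespace FormData

open PointedCover

variable {X : Type*} [TopologicalSpace X]

/-- The Čech class is computed by any family of local primitives. -/
theorem cechClass_eq_mk (φ : FormData X) (U : PointedCover X) (c : U.Z1) (q : X → X → ℝ)
    (hq : ∀ x, ∀ p ∈ φ.charts, DiffLocallyConstant p (U.nhd x, q x))
    (hc : ∀ x y p, c.1 x y p = q y p - q x p) : φ.cechClass = CechH1.mk U c := by
  let W : PointedCover X :=
    { nhd := fun x => φ.cover.nhd x ⊓ U.nhd x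
      mem_nhd := fun x => ⟨φ.cover.mem_nhd x, U.mem_nhd x⟩ }
  refine CechH1.mk_eq_mk (W := W) (fun x => inf_le_left) (fun x => inf_le_right) _ _
    (fun x => diff (φ.chartAt x) (U.nhd x, q x) (hq x _ (φ.chartAt_mem x)) _ inf_le_left
      inf_le_right) ?_
  funext x y
  ext p
  change ((φ.chartAt y).2 p.1 - q y p.1) - ((φ.chartAt x).2 p.1 - q x p.1)
    = ((φ.chartAt y).2 p.1 - (φ.chartAt x).2 p.1) - c.1 x y ⟨p.1, p.2.1.2, p.2.2.2⟩
  rw [hc]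
  ring

/-- Adding `g` to every local primitive leaves their differences unchanged. -/
theorem cechClass_addDifferential (φ : FormData X) (g : C(X, ℝ)) :
    (φ.addDifferential g).cechClass = φ.cechClass := by
  refine cechClass_eq_mk _ φ.cover φ.cocycle (fun x y => (φ.chartAt x).2 y + g y) ?_ ?_
  · rintro x _ ⟨p, hp, rfl⟩ y hyp hy
    filter_upwards [φ.compatible p hp _ (φ.chartAt_mem x) y hyp hy] with z hz
    simpa using hz
  · intro x y p
    change (φ.chartAt y).2 p - (φ.chartAt x).2 p = _
    ring

/-- On a compact space every Čech class is the class of a continuous closed one-form. -/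
theorem exists_cechClass_eq [CompactSpace X] [T2Space X] (ξ : CechH1 X) :
    ∃ φ : FormData X, φ.cechClass = ξ := by
  classical
  obtain ⟨U, c, rfl⟩ := CechH1.exists_mk ξ
  obtain ⟨S, hS⟩ := isCompact_univ.elim_finite_subcover (fun x => (U.nhd x : Set X))
    (fun x => (U.nhd x).isOpen) (fun x _ => mem_iUnion.2 ⟨x, U.mem_nhd x⟩)
  obtain ⟨ρ, hρ⟩ := PartitionOfUnity.exists_isSubordinate (isClosed_univ (X := X))
    (fun z : S => (U.nhd z : Set X)) (fun z => (U.nhd z).isOpen) (fun x hx => by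
      obtain ⟨z, hz, hxz⟩ := mem_iUnion₂.1 (hS hx)
      exact mem_iUnion.2 ⟨⟨z, hz⟩, hxz⟩)
  -- the cocycle, extended by zero
  let e : X → X → X → ℝ := fun z x p =>
    if h : p ∈ U.nhd z ⊓ U.nhd x then c.1 z x ⟨p, h⟩ else 0
  have he : ∀ z x p, p ∈ U.nhd z → p ∈ U.nhd x → ContinuousAt (e z x) p := by
    intro z x p hz hx
    refine (continuousAt_const (y := c.1 z x ⟨p, hz, hx⟩)).congr ?_
    filter_upwards [(c.1 z x).eventually_apply_eq ⟨p, hz, hx⟩,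
      (U.nhd z ⊓ U.nhd x).isOpen.mem_nhds ⟨hz, hx⟩] with y h hy
    have hy' : e z x y = c.1 z x ⟨y, hy⟩ := dif_pos hy
    rw [hy', h hy]
  have hcoc : ∀ z x y p, p ∈ U.nhd z → (hx : p ∈ U.nhd x) → (hy : p ∈ U.nhd y) →
      e z y p - e z x p = c.1 x y ⟨p, hx, hy⟩ := by
    intro z x y p hz hx hy
    have h := congrArg (fun k : U.C2 => k z x y ⟨p, ⟨hz, hx⟩, hy⟩) (LinearMap.mem_ker.1 c.2)
    change c.1 x y ⟨p, hx, hy⟩ - c.1 z y ⟨p, hz, hy⟩ + c.1 z x ⟨p, hz, hx⟩ = 0 at h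
    have h1 : e z y p = c.1 z y ⟨p, hz, hy⟩ := dif_pos ⟨hz, hy⟩
    have h2 : e z x p = c.1 z x ⟨p, hz, hx⟩ := dif_pos ⟨hz, hx⟩
    rw [h1, h2]
    linarith
  -- The cocycle identity gives `c_zy - c_zx = c_xy`; averaging with weights `ρ z` exhibits the
  -- cocycle as `q y - q x`.
  let q : X → X → ℝ := fun x p => ∑ z : S, ρ z p * e z x p
  have hdiff : ∀ x y p, (hx : p ∈ U.nhd x) → (hy : p ∈ U.nhd y) →
      q y p - q x p = c.1 x y ⟨p, hx, hy⟩ := by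
    intro x y p hx hy
    have hone : ∑ z : S, ρ z p = 1 := by
      rw [← finsum_eq_sum_of_fintype]
      exact ρ.sum_eq_one (mem_univ p)
    simp only [q]
    rw [← Finset.sum_sub_distrib, ← one_mul (c.1 x y ⟨p, hx, hy⟩), ← hone, Finset.sum_mul]
    refine Finset.sum_congr rfl fun z _ => ?_
    by_cases hz : p ∈ U.nhd z
    · rw [← mul_sub, hcoc z x y p hz hx hy]
    · have : ρ z p = 0 := by
        by_contra h
        exact hz (hρ z (subset_tsupport _ h))
      simp [this]
  have hqc : ∀ x, ContinuousOn (q x) (U.nhd x) := by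
    intro x p hx
    refine ContinuousAt.continuousWithinAt ?_
    refine tendsto_finsetSum _ fun z _ => ?_
    by_cases hz : p ∈ tsupport (ρ z)
    · exact (ρ z).continuous.continuousAt.mul (he z x p (hρ z hz) hx)
    · have h0 : (fun y => ρ z y * e z x y) =ᶠ[𝓝 p] fun _ => 0 := by
        filter_upwards [(isClosed_tsupport (ρ z)).isOpen_compl.mem_nhds hz] with y hy
        rw [image_eq_zero_of_notMem_tsupport hy, zero_mul]
      exact (continuousAt_const (y := (0 : ℝ))).congr h0.symm
  have hlc : ∀ x y, DiffLocallyConstant (U.nhd x, q x) (U.nhd y, q y) := by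
    intro x y p hx hy
    filter_upwards [(c.1 y x).eventually_apply_eq ⟨p, hy, hx⟩, (U.nhd x).isOpen.mem_nhds hx,
      (U.nhd y).isOpen.mem_nhds hy] with p' h' hx' hy'
    have := h' ⟨hy', hx'⟩
    change q x p' - q y p' = q x p - q y p
    rw [hdiff y x p' hy' hx', hdiff y x p hy hx]
    exact this
  let φ : FormData X :=
    { charts := range fun x => (U.nhd x, q x)
      covers := fun x => ⟨_, ⟨x, rfl⟩, U.mem_nhd x⟩
      continuousOn := by
        rintro _ ⟨x, rfl⟩
        exact hqc x
      compatible := by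
        rintro _ ⟨x, rfl⟩ _ ⟨y, rfl⟩
        exact hlc x y }
  refine ⟨φ, cechClass_eq_mk φ U c q ?_ fun x y p => (hdiff x y p p.2.1 p.2.2).symm⟩
  rintro x _ ⟨y, rfl⟩
  exact hlc y x

/-- A one-form whose class vanishes on a subspace has a primitive there. -/
theorem exists_primitive_of_restrict_eq_zero (φ : FormData X) (A : Set X)
    (h : CechH1.restrict A φ.cechClass = 0) :
    ∃ f : A → ℝ, ∀ p ∈ φ.charts, ∀ x : A, x.1 ∈ p.1 →
      ∀ᶠ y : A in 𝓝 x, p.2 y - f y = p.2 x - f x := by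
  rw [cechClass, CechH1.restrict_mk] at h
  obtain ⟨V, hV, s, hs⟩ := CechH1.exists_of_mk_eq_zero h
  -- The functions `φ_x - s_x` agree on overlaps in `A`, because the cochain `s` bounds the cocycle
  -- there; `f` is the glued function, read off at the index point itself.
  refine ⟨fun x => (φ.chartAt x).2 x - s x ⟨x, V.mem_nhd x⟩, fun p hp x hx => ?_⟩
  have hcpt := φ.compatible p hp _ (φ.chartAt_mem x) x hx (φ.mem_chartAt x)
  filter_upwards [continuous_subtype_val.continuousAt.eventually hcpt,
    (s x).eventually_apply_eq ⟨x, V.mem_nhd x⟩,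
    (V.nhd x).isOpen.mem_nhds (V.mem_nhd x)] with y h1 h2 hyV
  have h3 := congrArg (fun k : V.C1 => k x y ⟨y, hyV, V.mem_nhd y⟩) hs
  change s y ⟨y, V.mem_nhd y⟩ - s x ⟨y, hyV⟩ = (φ.chartAt y).2 y - (φ.chartAt x).2 y at h3
  have h4 := h2 hyV
  linarith

end FormData

/-! ### One-forms vanishing near a closed subspace -/

namespace FormData

variable {X : Type*} [TopologicalSpace X]

/-- A primitive on a closed subspace yields a primitive on a neighbourhood. -/
theorem exists_primitive_near [CompactSpace X] [T2Space X] (φ : FormData X) {A : Set X}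
    (hA : IsClosed A) (f : A → ℝ)
    (hf : ∀ p ∈ φ.charts, ∀ x : A, x.1 ∈ p.1 → ∀ᶠ y : A in 𝓝 x, p.2 y - f y = p.2 x - f x) :
    ∃ (U : Set X) (F : X → ℝ), IsOpen U ∧ A ⊆ U ∧ ∀ p ∈ φ.charts, ∀ x ∈ p.1, x ∈ U →
      ∀ᶠ y in 𝓝 x, p.2 y - F y = p.2 x - F x := by
  classical
  -- local primitives near the points of `A` that agree with `f` on `A`
  have hloc : ∀ a : A, ∃ (O : Set X) (q : X → ℝ), IsOpen O ∧ a.1 ∈ O ∧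
      (∀ p ∈ φ.charts, ∀ x ∈ p.1, x ∈ O → ∀ᶠ y in 𝓝 x, p.2 y - q y = p.2 x - q x) ∧
      ∀ y : A, y.1 ∈ O → q y = f y := by
    intro a
    obtain ⟨p, hp, ha⟩ := φ.covers a
    have h := hf p hp a ha
    rw [nhds_subtype_eq_comap, eventually_comap] at h
    obtain ⟨O, hO, hOo, haO⟩ := eventually_nhds_iff.1 (h.and (p.1.isOpen.mem_nhds ha))
    refine ⟨O, fun y => p.2 y - (p.2 a - f a), hOo, haO, fun p' hp' x hx hxO => ?_, fun y hy => ?_⟩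
    · filter_upwards [φ.compatible p' hp' p hp x hx (hO x hxO).2] with y hy
      linarith
    · have := (hO y hy).1 y rfl
      linarith
  choose O q hOo hO hq hqf using hloc
  obtain ⟨S, hS⟩ := hA.isCompact.elim_finite_subcover O hOo
    (fun a ha => mem_iUnion.2 ⟨⟨a, ha⟩, hO ⟨a, ha⟩⟩)
  obtain ⟨v, hAv, hvo, hvO⟩ := exists_subset_iUnion_closure_subset (u := fun i : S => O i) hA
    (fun i => hOo i) (fun _ _ => Set.toFinite _) (fun x hx => by
      obtain ⟨z, hz, hxz⟩ := mem_iUnion₂.1 (hS hx)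
      exact mem_iUnion.2 ⟨⟨z, hz⟩, hxz⟩)
  -- Local primitives that agree at a point agree near it. Shrinking to finitely many closed sets
  -- means that only the indices present at `x` occur near `x`, so agreement on `A` spreads to a
  -- neighbourhood.
  have hqq : ∀ i j : S, ∀ x, x ∈ O i → x ∈ O j → q i x = q j x →
      ∀ᶠ y in 𝓝 x, q i y = q j y := by
    intro i j x hi hj hx
    obtain ⟨p, hp, hxp⟩ := φ.covers x
    filter_upwards [hq i p hp x hxp hi, hq j p hp x hxp hj] with y h1 h2
    linarith
  have hcl : ∀ x, ∀ᶠ y in 𝓝 x, ∀ i : S, y ∈ closure (v i) → x ∈ closure (v i) := by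
    intro x
    refine eventually_all.2 fun i => ?_
    by_cases hx : x ∈ closure (v i)
    · exact Eventually.of_forall fun _ _ => hx
    · filter_upwards [isClosed_closure.isOpen_compl.mem_nhds hx] with y hy hy'
      exact absurd hy' hy
  let G : Set X := {y | (∃ i : S, y ∈ closure (v i)) ∧
    ∀ i j : S, y ∈ closure (v i) → y ∈ closure (v j) → q i y = q j y}
  have hnear : ∀ x, (∀ i j : S, x ∈ closure (v i) → x ∈ closure (v j) → q i x = q j x) →
      ∀ᶠ y in 𝓝 x, ∀ i j : S, x ∈ closure (v i) → x ∈ closure (v j) → q i y = q j y := by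
    intro x hx
    refine eventually_all.2 fun i => eventually_all.2 fun j => ?_
    by_cases hi : x ∈ closure (v i)
    · by_cases hj : x ∈ closure (v j)
      · filter_upwards [hqq i j x (hvO i hi) (hvO j hj) (hx i j hi hj)] with y hy _ _
        exact hy
      · exact Eventually.of_forall fun _ _ h => absurd h hj
    · exact Eventually.of_forall fun _ h => absurd h hi
  refine ⟨interior G, fun y => if h : ∃ i : S, y ∈ closure (v i) then q h.choose y else 0,
    isOpen_interior, ?_, ?_⟩
  · intro z hz
    rw [mem_interior_iff_mem_nhds]
    obtain ⟨k, hk⟩ := mem_iUnion.1 (hAv hz)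
    have hz' : ∀ i j : S, z ∈ closure (v i) → z ∈ closure (v j) → q i z = q j z :=
      fun i j hi hj => (hqf i ⟨z, hz⟩ (hvO i hi)).trans (hqf j ⟨z, hz⟩ (hvO j hj)).symm
    filter_upwards [hcl z, hnear z hz', (hvo k).mem_nhds hk] with y h1 h2 h3
    exact ⟨⟨k, subset_closure h3⟩, fun i j hi hj => h2 i j (h1 i hi) (h1 j hj)⟩
  · intro p hp x hxp hx
    have hxG : x ∈ G := interior_subset hx
    obtain ⟨i, hi⟩ := hxG.1
    have hF : ∀ᶠ y in 𝓝 x,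
        (if h : ∃ i : S, y ∈ closure (v i) then q h.choose y else 0) = q i y := by
      filter_upwards [hcl x, hnear x hxG.2, isOpen_interior.mem_nhds hx] with y h1 h2 h3
      have h4 := (interior_subset h3 : y ∈ G).1
      rw [dif_pos h4]
      exact h2 _ _ (h1 _ h4.choose_spec) hi
    filter_upwards [hF, hq i p hp x hxp (hvO i hi)] with y h1 h2
    rw [h1, hF.self_of_nhds, h2]

/-- A collection whose class vanishes on a closed subspace `A` is cohomologous to one which vanishes
near `A`. -/
theorem exists_vanishesOn_of_restrict_eq_zero [CompactSpace X] [T2Space X] (φ : FormData X)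
    {A : Set X} (hA : IsClosed A) (h : CechH1.restrict A φ.cechClass = 0) :
    ∃ (ψ : FormData X) (W : Set X), ψ.cechClass = φ.cechClass ∧ IsOpen W ∧ A ⊆ W ∧
      ψ.VanishesOn W := by
  obtain ⟨f, hf⟩ := φ.exists_primitive_of_restrict_eq_zero A h
  obtain ⟨U, F, hU, hAU, hF⟩ := φ.exists_primitive_near hA f hf
  obtain ⟨W, hW, hAW, hWU⟩ := normal_exists_closure_subset hA hU hAU
  have hFc : ContinuousOn F (closure W) := by
    intro x hx
    obtain ⟨p, hp, hxp⟩ := φ.covers x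
    have hpc := (φ.continuousOn p hp).continuousAt (p.1.isOpen.mem_nhds hxp)
    refine (ContinuousAt.congr (hpc.sub (continuousAt_const (y := p.2 x - F x)))
      ?_).continuousWithinAt
    filter_upwards [hF p hp x hxp (hWU hx)] with y hy
    change p.2 y - (p.2 x - F x) = F y
    linarith
  -- Tietze extension of the local primitive from `closure W` to the whole space.
  obtain ⟨g, hg⟩ := ContinuousMap.exists_restrict_eq isClosed_closure
    (⟨_, hFc.domRestrict⟩ : C(closure W, ℝ))
  have hgF : ∀ x ∈ W, g x = F x := fun x hx =>
    congrArg (fun k : C(closure W, ℝ) => k ⟨x, subset_closure hx⟩) hg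
  refine ⟨φ.addDifferential (-g), W, φ.cechClass_addDifferential _, hW, hAW, ?_⟩
  rintro _ ⟨p, hp, rfl⟩ x hxp hxW
  filter_upwards [hF p hp x hxp (hWU (subset_closure hxW)), hW.mem_nhds hxW] with y hy hyW
  simp only [ContinuousMap.neg_apply, hgF x hxW, hgF y hyW]
  linarith

end FormData

/-! ### Construction of the Lyapunov one-form -/

namespace Flow

variable {X : Type*} [MetricSpace X] (Φ : Flow ℝ X)

/-- A large multiple of a Lyapunov function dominates a one-form vanishing near the chain recurrent
set. -/
theorem exists_mul_dominates [CompactSpace X] {φ : FormData X} {W R : Set X} (hW : IsOpen W) (hRW : R ⊆ W)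
    (hR : IsInvariant Φ R) (hφ : φ.VanishesOn W) (L : C(X, ℝ))
    (hL : ∀ x ∉ R, L (Φ 1 x) < L x) :
    ∃ r : ℝ, ∀ x ∉ R, φ.lineIntegral (Φ.trajectory x 1) + r * (L (Φ 1 x) - L x) < 0 := by
  let a : X → ℝ := fun x => φ.lineIntegral (Φ.trajectory x 1)
  let D : X → ℝ := fun x => L x - L (Φ 1 x)
  have ha : Continuous a :=
    (Φ.continuous_lineIntegral_trajectory φ).comp (continuous_id.prodMk continuous_const)
  have hD : Continuous D :=
    L.continuous.sub (L.continuous.comp (Φ.continuous continuous_const continuous_id))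
  let V : Set X := {x | MapsTo (Φ.trajectory x 1) univ W}
  have hV : IsOpen V := (ContinuousMap.isOpen_setOfPred_mapsTo isCompact_univ hW).preimage
    (Φ.continuous_trajectory.comp (continuous_id.prodMk continuous_const))
  have hRV : R ⊆ V := fun x hx s _ => hRW (hR _ hx)
  have hDpos : ∀ x ∉ R, 0 < D x := fun x hx => sub_pos.2 (hL x hx)
  -- On `V` the integral `a` is zero. The complement of `V` is compact and misses `R`, so `D` is
  -- positive there and the quotient is bounded.
  obtain ⟨M, hM⟩ := hV.isClosed_compl.isCompact.bddAbove_image (f := fun x => a x / D x)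
    (ha.continuousOn.div hD.continuousOn fun x hx => (hDpos x fun h => hx (hRV h)).ne')
  refine ⟨max M 0 + 1, fun x hx => ?_⟩
  have hpos := hDpos x hx
  suffices a x < (max M 0 + 1) * D x by
    have e : L (Φ 1 x) - L x = -D x := by simp [D]
    rw [e]
    linarith
  by_cases hxV : x ∈ V
  · have : a x = 0 := hφ.lineIntegral_eq_zero fun s => hxV (mem_univ s)
    rw [this]
    positivity
  · have h1 : a x / D x ≤ M := hM (mem_image_of_mem _ hxV)
    rw [← div_lt_iff₀ hpos]
    linarith [le_max_left M 0]

/-- If `B` is the primitive of `φ + r dL` along trajectories, then adding to `φ` the differential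
of the average of `B` over unit time yields a form whose integrals are averages of the integrals
of `φ + r dL`. -/
theorem lineIntegral_average (φ : FormData X) (L : C(X, ℝ)) (r : ℝ) (h : C(X, ℝ))
    (hh : ∀ x, h x = ∫ s in (0 : ℝ)..1, (φ.lineIntegral (Φ.trajectory x s) + r * L (Φ s x)))
    (x : X) {t : ℝ} (ht : 0 ≤ t) :
    (φ.addDifferential h).lineIntegral (Φ.trajectory x t) =
      ∫ s in (0 : ℝ)..t, (φ.lineIntegral (Φ.trajectory (Φ s x) 1) +
        r * (L (Φ 1 (Φ s x)) - L (Φ s x))) := by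
  let B : ℝ → ℝ := fun s => φ.lineIntegral (Φ.trajectory x s) + r * L (Φ s x)
  have hB : Continuous B :=
    ((Φ.continuous_lineIntegral_trajectory φ).comp (continuous_const.prodMk continuous_id)).add
      (continuous_const.mul (L.continuous.comp (Φ.continuous continuous_id continuous_const)))
  have hBi : ∀ a b, IntervalIntegrable B MeasureTheory.volume a b := hB.intervalIntegrable
  have hBs : ∀ u a b, IntervalIntegrable (fun s => B (s + u)) MeasureTheory.volume a b :=
    fun u => (hB.comp (continuous_add_const u)).intervalIntegrable
  have e0 : Φ.trajectory x t 0 = x := by simp [trajectory_apply]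
  have e1 : Φ.trajectory x t 1 = Φ t x := by simp [trajectory_apply]
  have hx : h x = ∫ s in (0 : ℝ)..1, B s := hh x
  have hxt : h (Φ t x) = (∫ s in t..(t + 1), B s) - φ.lineIntegral (Φ.trajectory x t) := by
    have : h (Φ t x) =
        ∫ s in (0 : ℝ)..1, (B (s + t) - φ.lineIntegral (Φ.trajectory x t)) := by
      rw [hh]
      refine intervalIntegral.integral_congr fun s hs => ?_
      rw [uIcc_of_le zero_le_one] at hs
      simp only [B]
      rw [add_comm s t, Φ.lineIntegral_trajectory_add φ x ht hs.1, add_comm t s, Φ.map_add s t x]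
      ring
    rw [this, intervalIntegral.integral_sub (hBs t _ _) (by simp), intervalIntegral.integral_comp_add_right]
    simp [add_comm]
  have hshift : ∫ s in (0 : ℝ)..t, B (s + 1) = ∫ s in (1 : ℝ)..(t + 1), B s := by
    rw [intervalIntegral.integral_comp_add_right, zero_add]
  rw [FormData.lineIntegral_addDifferential, e0, e1, hxt, hx]
  have hr : ∫ s in (0 : ℝ)..t, (φ.lineIntegral (Φ.trajectory (Φ s x) 1) +
        r * (L (Φ 1 (Φ s x)) - L (Φ s x))) = ∫ s in (0 : ℝ)..t, (B (s + 1) - B s) := by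
    refine intervalIntegral.integral_congr fun s hs => ?_
    rw [uIcc_of_le ht] at hs
    simp only [B]
    rw [Φ.lineIntegral_trajectory_add φ x hs.1 zero_le_one, add_comm s 1, Φ.map_add 1 s x]
    ring
  rw [hr, intervalIntegral.integral_sub (hBs 1 _ _) (hBi _ _), hshift]
  -- The integral of `B` over `[t, t+1]` minus that over `[0, 1]` equals the one over `[1, t+1]`
  -- minus that over `[0, t]`.
  have := intervalIntegral.integral_interval_sub_interval_comm (hBi t (t + 1)) (hBi 0 1) (hBi t 0)
  rw [intervalIntegral.integral_symm 0 t, intervalIntegral.integral_symm 1 (t + 1)] at this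
  linarith

end Flow

theorem corollary1p2 {X : Type*} [MetricSpace X] [CompactSpace X] [LocallyPathConnectedSpace X]
    (Φ : Flow ℝ X) (ξ : CechH1 X) (hξ : CechH1.restrict Φ.chainRecurrentSet ξ = 0) :
    ∃ ω : ClosedOneForm X, ω.cechClass = ξ ∧ IsLyapunovOneForm Φ Φ.chainRecurrentSet ω := by
  have hR := Φ.isClosed_chainRecurrentSet
  have hinv := Φ.isInvariant_chainRecurrentSet
  obtain ⟨φ', rfl⟩ := FormData.exists_cechClass_eq ξ
  obtain ⟨φ, W, hφ', hW, hRW, hφ⟩ := φ'.exists_vanishesOn_of_restrict_eq_zero hR hξ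
  obtain ⟨L, hL, hLR⟩ := Φ.exists_lyapunov_function
  obtain ⟨r, hr⟩ := Φ.exists_mul_dominates hW hRW hinv hφ L hL
  let h : C(X, ℝ) :=
    ⟨fun x => ∫ s in (0 : ℝ)..1, (φ.lineIntegral (Φ.trajectory x s) + r * L (Φ s x)),
      intervalIntegral.continuous_parametric_intervalIntegral_of_continuous'
        ((Φ.continuous_lineIntegral_trajectory φ).add (continuous_const.mul
          (L.continuous.comp (Φ.continuous continuous_snd continuous_fst)))) 0 1⟩
  -- Orbits in the chain recurrent set stay where `φ` vanishes, and `L` is constant on them, so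
  -- averaging changes nothing. Thus `h` inherits from `L` its constancy on components.
  have hhR : ∀ x ∈ Φ.chainRecurrentSet, h x = r * L x := by
    intro x hx
    have : h x = ∫ s in (0 : ℝ)..1, r * L x := by
      refine intervalIntegral.integral_congr fun s _ => ?_
      have h1 : φ.lineIntegral (Φ.trajectory x s) = 0 :=
        hφ.lineIntegral_eq_zero fun u => hRW (hinv _ hx)
      have h2 : L (Φ s x) = L x := by
        refine hLR _ ?_ (Φ.isPreconnected_range_orbit x) _ ⟨s, rfl⟩ _ ⟨0, by simp⟩
        rintro _ ⟨u, rfl⟩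
        exact hinv u hx
      rw [h1, h2, zero_add]
    simpa using this
  refine ⟨Quotient.mk _ (φ.addDifferential h), ?_, hR, hinv, ?_, W, hW, hRW,
    h.comp ⟨Subtype.val, continuous_subtype_val⟩, ?_, ?_⟩
  · exact (φ.cechClass_addDifferential h).trans hφ'
  · intro x hx t ht
    change (φ.addDifferential h).lineIntegral (Φ.trajectory x t) < 0
    rw [Φ.lineIntegral_average φ L r h (fun _ => rfl) x ht.le, ← neg_pos,
      ← intervalIntegral.integral_neg]
    have horb : Continuous fun s : ℝ => Φ s x := Φ.continuous continuous_id continuous_const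
    refine intervalIntegral.intervalIntegral_pos_of_pos_on (Continuous.intervalIntegrable ?_ _ _)
      (fun s _ => neg_pos.2 (hr _ fun hs => hx ?_)) ht
    · refine (((Φ.continuous_lineIntegral_trajectory φ).comp
        (horb.prodMk continuous_const)).add (continuous_const.mul ?_)).neg
      exact (L.continuous.comp (Φ.continuous continuous_const horb)).sub (L.continuous.comp horb)
    · have := hinv (-s) hs
      rwa [← Φ.map_add, neg_add_cancel, Φ.map_zero_apply] at this
  · refine Quotient.sound (FormData.equiv_of_diff ?_)
    rintro _ ⟨_, ⟨p, hp, rfl⟩, rfl⟩ _ rfl x hxp -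
    filter_upwards [continuous_subtype_val.continuousAt.eventually (hφ p hp x.1 hxp x.2)] with y hy
    change p.2 y + h y - h y = p.2 x + h x - h x
    rw [hy]
    ring
  · intro a b ha hb
    have hbR := connectedComponentIn_subset _ _ hb
    change h a = h b
    rw [hhR _ ha, hhR _ hbR]
    rw [hLR _ (connectedComponentIn_subset _ _) isPreconnected_connectedComponentIn _
      (mem_connectedComponentIn ha) _ hb]
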